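/- Let $k$ be an algebraically closed field of characteristic $p>0$; all modules are finitely generated right modules. Let $G$ and $G'$ be finite groups with a common $p$-subgroup $P$ (that is, $P$ is a $p$-group embedded in $G$ and in $G'$), and let $\Delta P=\{(u,u)\mid u\in P\}\leq G\times G'$. Let $M$ be a trivial source $k[G\times G']$-module (an indecomposable direct summand of a finite direct sum of modules induced from trivial modules of subgroups) with vertex $\Delta P$, regarded as a $kG$-$kG'$-bimodule via $g\cdot m\cdot g'=m(g^{-1},g')$. Let $Z$ be a proper subgroup of $P$ that is contained in both $Z(G)$ and $Z(G')$. Then $\mathrm{soc}(kG)\otimes_{kG}M$ is a nonzero $kG'$-module having no nonzero $Z$-projective direct summand. In particular, for every simple $kG$-module $S$, the $kG'$-module $S\otimes_{kG}M$ has no nonzero $Z$-projective direct summand. (A $kG'$-module is $Z$-projective if it is a direct summand of a module induced from $Z$ to $G'$; a vertex of an indecomposable module is a minimal subgroup relative to which the module is projective.) -/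

import Mathlib

open scoped TensorProduct DirectSum MonoidAlgebra

noncomputable section

/-! Modules over group algebras are written as representations over `k`.  A right `kG`-module `V`
corresponds to the representation `ρ` of `G` on `V` with `v · g = ρ g⁻¹ v`; submodules, direct
summands, simplicity, induction and so on are the same on both sides. -/

namespace RightGroupModules

section Basic

variable {k G V W : Type*} [Field k] [Group G] [AddCommGroup V] [Module k V]
  [AddCommGroup W] [Module k W]

/-- `σ` is isomorphic to a direct summand of `ρ`. -/
def IsSummand (σ : Representation k G W) (ρ : Representation k G V) : Prop :=
  ∃ (i : Representation.IntertwiningMap σ ρ) (q : Representation.IntertwiningMap ρ σ),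
    ∀ w : W, q (i w) = w

/-- `ρ` is nonzero and is not the direct sum of two nonzero submodules. -/
def IsIndecomposable (ρ : Representation k G V) : Prop :=
  Nontrivial V ∧ ∀ U U' : Subrepresentation ρ, IsCompl U U' → U = ⊥ ∨ U' = ⊥

/-- A `p`-permutation module: a direct summand of a finite direct sum of modules induced from
trivial modules `k_H` of subgroups. -/
def IsPPermutation (ρ : Representation k G V) : Prop :=
  ∃ (r : ℕ) (H : Fin r → Subgroup G),
    IsSummand ρ (Representation.directSum fun j =>
      Representation.ind (H j).subtype (Representation.trivial k (H j) k))

/-- A trivial source module: an indecomposable `p`-permutation module. -/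
def IsTrivialSource (ρ : Representation k G V) : Prop :=
  IsIndecomposable ρ ∧ IsPPermutation ρ

/-- Relative `H`-projectivity of a finitely generated module: it is a direct summand of the module
induced from some finitely generated `kH`-module (written on a coordinate space `kⁿ`). -/
def IsRelProjective (H : Subgroup G) (ρ : Representation k G V) : Prop :=
  ∃ (n : ℕ) (σ : Representation k H (Fin n → k)),
    IsSummand ρ (Representation.ind H.subtype σ)

/-- `Q` is a vertex of the (indecomposable) module `ρ`: a minimal subgroup among those relative to
which `ρ` is projective. -/
def IsVertex (Q : Subgroup G) (ρ : Representation k G V) : Prop :=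
  Minimal (fun H : Subgroup G => IsRelProjective H ρ) Q

/-- Every direct summand of `ρ` that is `H`-projective is zero. -/
def HasNoNonzeroRelProjectiveSummand (H : Subgroup G) (ρ : Representation k G V) : Prop :=
  ∀ U U' : Subrepresentation ρ, IsCompl U U' → IsRelProjective H U.toRepresentation → U = ⊥

/-- The socle: the sum of all simple submodules. -/
def socle (ρ : Representation k G V) : Subrepresentation ρ where
  toSubmodule := ⨆ U : {U : Subrepresentation ρ // U.toRepresentation.IsIrreducible},
    U.1.toSubmodule
  apply_mem_toSubmodule g v hv := by
    have h : (⨆ U : {U : Subrepresentation ρ // U.toRepresentation.IsIrreducible},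
        U.1.toSubmodule) ≤ (⨆ U : {U : Subrepresentation ρ //
          U.toRepresentation.IsIrreducible}, U.1.toSubmodule).comap (ρ g) :=
      iSup_le fun U x hx =>
        (le_iSup (fun U : {U : Subrepresentation ρ // U.toRepresentation.IsIrreducible} =>
          U.1.toSubmodule) U) (U.1.apply_mem_toSubmodule g hx)
    exact h hv

end Basic

section Regular

variable (k G : Type*) [Field k] [Group G]

/-- The right regular module `kG`, on which `g` acts by right multiplication
(so `a · g = rightRegular g⁻¹ a = a * g`). -/
def rightRegular : Representation k G k[G] where
  toFun g := LinearMap.mulRight k (MonoidAlgebra.single g⁻¹ (1 : k))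
  map_one' := by
    ext
    simp
  map_mul' g h := by
    ext
    simp [mul_assoc]

/-- `soc(kG)` as a right `kG`-module. -/
abbrev socRegular : Representation k G (socle (rightRegular k G)).toSubmodule :=
  (socle (rightRegular k G)).toRepresentation

end Regular

section Tensor

variable {k G G' S M : Type*} [Field k] [Group G] [Group G'] [AddCommGroup S] [Module k S]
  [AddCommGroup M] [Module k M]

/-! A right `k[G × G']`-module `M` is a `kG`-`kG'`-bimodule via `g · m · g' = m · (g⁻¹, g')`; in
terms of the corresponding representation `ρ` of `G × G'` this is `ρ (g, g'⁻¹) m`. -/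

/-- The subspace of `S ⊗ₖ M` spanned by all `(s · g) ⊗ m - s ⊗ (g · m)`. -/
def balancedRelations (σ : Representation k G S) (ρ : Representation k (G × G') M) :
    Submodule k (S ⊗[k] M) :=
  Submodule.span k {t | ∃ (s : S) (g : G) (m : M),
    t = (σ g⁻¹ s) ⊗ₜ[k] m - s ⊗ₜ[k] (ρ (g, 1) m)}

/-- The action of `G'` on `S ⊗ₖ M` through the second factor. -/
def tensorRight (S : Type*) [AddCommGroup S] [Module k S] (ρ : Representation k (G × G') M) :
    Representation k G' (S ⊗[k] M) where
  toFun g' := (ρ (1, g')).lTensor S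
  map_one' := by
    have h : ρ ((1 : G), (1 : G')) = LinearMap.id := ρ.map_one
    rw [h, LinearMap.lTensor_id]
    rfl
  map_mul' a b := by
    have h : ρ ((1 : G), a * b) = ρ (1, a) ∘ₗ ρ (1, b) := by
      rw [← Module.End.mul_eq_comp, ← map_mul]
      simp
    rw [h, LinearMap.lTensor_comp]
    rfl

theorem balancedRelations_le_comap (σ : Representation k G S) (ρ : Representation k (G × G') M)
    (g' : G') :
    balancedRelations σ ρ ≤ (balancedRelations σ ρ).comap (tensorRight S ρ g') := by
  refine Submodule.span_le.2 ?_
  rintro _ ⟨s, g, m, rfl⟩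
  refine Submodule.subset_span ⟨s, g, ρ (1, g') m, ?_⟩
  have h : ρ ((1 : G), g') (ρ (g, (1 : G')) m) = ρ (g, 1) (ρ (1, g') m) := by
    rw [← Module.End.mul_apply, ← Module.End.mul_apply, ← map_mul, ← map_mul]
    simp
  simp [tensorRight, h]

/-- The vector space `S ⊗_{kG} M`. -/
abbrev TensorOver (σ : Representation k G S) (ρ : Representation k (G × G') M) : Type _ :=
  (S ⊗[k] M) ⧸ balancedRelations σ ρ

/-- The right `kG'`-module `S ⊗_{kG} M`, for a right `kG`-module `S` and a right
`k[G × G']`-module `M` regarded as a `kG`-`kG'`-bimodule. -/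
def tensorOver (σ : Representation k G S) (ρ : Representation k (G × G') M) :
    Representation k G' (TensorOver σ ρ) :=
  (tensorRight S ρ).quotient (balancedRelations σ ρ) (balancedRelations_le_comap σ ρ)

end Tensor

/-- The diagonal subgroup `ΔP = {(u, u) | u ∈ P}` of `G × G'`, for a group `P` embedded in `G`
by `i` and in `G'` by `i'`. -/
def diagonalSubgroup {P G G' : Type*} [Group P] [Group G] [Group G'] (i : P →* G) (i' : P →* G') :
    Subgroup (G × G') :=
  (i.prod i').range

end RightGroupModules

end

/-!
The identity of a module that is projective relative to a subgroup `H` is a relative trace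
`∑ g θ g⁻¹` over cosets of `H` (Higman's criterion), and over an indecomposable module every such
trace is nilpotent unless the module is `H`-projective. Write `D` for the diagonal copy of `Z` in
`G × G'`. It is a proper subgroup of the vertex of `M`, so `M` is not `D`-projective
and traces from `D` on `M` are nilpotent. As `D` is central and lies in the vertex, it acts trivially
on the trivial source module `M` (`apply_eq_self_of_mem_vertex`): `M` is a summand of a permutation
module `k[(G × G')/H]`, and `H` contains a conjugate of the vertex.

Nilpotency of traces, applied to operators of rank one, gives `sum_out_smul_eq_zero`: for a simple
`k[G × G']`-module `Y` on which `D` acts trivially, all sums `∑ χ(γ⁻¹ y) γ m` over `γ` in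
`(G × G')/D` vanish on `M`, since a nonzero one would embed `Y` in the fixed space of a trace.
As `k` is algebraically closed, this applies to `Y = V* ⊗ T` with `V` simple over `kG` and `T` simple
over `kG'`; the central `p`-subgroup `Z` acts trivially on both.

Since the vertex is diagonal, `M` is projective over `kG`. So the maps `s ⊗ m ↦ ∑ μ(g s) g m`
separate the points of `S ⊗_{kG} M` (`eq_zero_of_forall_contract_eq_zero`), and for semisimple `S`
the vanishing on `M` becomes the vanishing on `S ⊗_{kG} M` of all `∑ χ(q⁻¹ x) q` over `q` in `G'/Z`,
for `x` in a simple module `T` (`sum_smul_tensorOver_eq_zero`). On a nonzero `Z`-projective summand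
one of these would be nonzero, because the identity is a trace from `Z`. Semisimple modules
include both `soc(kG)` and the simple modules. Projectivity over `kG` also makes
`soc(kG) ⊗_{kG} M` nonzero (`nontrivial_socRegular_tensorOver`).
-/

namespace RightGroupModules

/-! ### Sums over coset representatives -/

section CosetSums

variable {Γ A : Type*} [Group Γ]

theorem apply_out_eq_of_mul_right_invariant {B : Type*} {H : Subgroup Γ} {f : Γ → B}
    (hf : ∀ γ, ∀ h ∈ H, f (γ * h) = f γ) (γ : Γ) : f (γ : Γ ⧸ H).out = f γ := by
  obtain ⟨h, hh⟩ := QuotientGroup.mk_out_eq_mul H γ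
  rw [hh, hf _ _ h.2]

theorem sum_out_mul_left [AddCommMonoid A] {H : Subgroup Γ} [Fintype (Γ ⧸ H)] {f : Γ → A}
    (hf : ∀ γ, ∀ h ∈ H, f (γ * h) = f γ) (g : Γ) :
    ∑ x : Γ ⧸ H, f (g * x.out) = ∑ x : Γ ⧸ H, f x.out := by
  refine Fintype.sum_bijective (fun x : Γ ⧸ H => g • x) (MulAction.bijective g) _ _ fun x => ?_
  conv_rhs => rw [← QuotientGroup.out_eq' x]
  exact (apply_out_eq_of_mul_right_invariant hf (g * x.out)).symm

/-- For a subgroup `D` of `G × G'` that meets `G × 1` trivially, with `D'` its projection to `G'`,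
the elements `(g, g')` with `g ∈ G` and `g'` running over representatives of `G' / D'` represent the
left cosets of `D`. -/
theorem sum_out_prod_range {G G' Q : Type*} [Group G] [Group G'] [Group Q] [Fintype G]
    [AddCommMonoid A] (j : Q →* G) (j' : Q →* G') (hj' : Function.Injective j')
    [Fintype ((G × G') ⧸ (j.prod j').range)] [Fintype (G' ⧸ j'.range)] {f : G × G' → A}
    (hf : ∀ γ, ∀ h ∈ (j.prod j').range, f (γ * h) = f γ) :
    ∑ x : (G × G') ⧸ (j.prod j').range, f x.out =
      ∑ g : G, ∑ q : G' ⧸ j'.range, f (g, q.out) := by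
  rw [← Fintype.sum_prod_type']
  symm
  refine Fintype.sum_bijective
    (fun x : G × (G' ⧸ j'.range) => (((x.1, x.2.out) : G × G') : (G × G') ⧸ (j.prod j').range))
    ⟨?_, ?_⟩ _ _ fun x => (apply_out_eq_of_mul_right_invariant hf _).symm
  · rintro ⟨g, q⟩ ⟨h, r⟩ hgh
    obtain ⟨u, hu⟩ := QuotientGroup.eq.1 hgh
    have h1 : j u = g⁻¹ * h := congrArg Prod.fst hu
    have h2 : j' u = q.out⁻¹ * r.out := congrArg Prod.snd hu
    have hqr : q = r := by
      rw [← QuotientGroup.out_eq' q, ← QuotientGroup.out_eq' r]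
      exact QuotientGroup.eq.2 ⟨u, h2⟩
    subst hqr
    have hu1 : u = 1 := hj' (by rw [h2, map_one, inv_mul_cancel])
    rw [hu1, map_one, eq_comm, inv_mul_eq_one] at h1
    rw [h1]
  · intro x
    obtain ⟨⟨a, b⟩, rfl⟩ := QuotientGroup.mk_surjective x
    obtain ⟨⟨_, u, rfl⟩, hu⟩ := QuotientGroup.mk_out_eq_mul j'.range b
    refine ⟨(a * j u, b), QuotientGroup.eq.2 ⟨u⁻¹, ?_⟩⟩
    ext
    · simp
    · simp [hu]

end CosetSums

/-! ### Relative traces and Higman's criterion -/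

section RelativeTraces

variable {k Γ V W : Type*} [Field k] [Group Γ] [AddCommGroup V] [Module k V]
  [AddCommGroup W] [Module k W]

/-- The action of a group element on `Module.End k V` by conjugation. -/
def conj (ρ : Representation k Γ V) (g : Γ) (θ : Module.End k V) : Module.End k V :=
  ρ g * θ * ρ g⁻¹

theorem conj_mul (ρ : Representation k Γ V) (g h : Γ) (θ : Module.End k V) :
    conj ρ (g * h) θ = conj ρ g (conj ρ h θ) := by
  simp only [conj, map_mul, mul_inv_rev, mul_assoc]

theorem conj_apply (ρ : Representation k Γ V) (g : Γ) (θ : Module.End k V) (v : V) :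
    conj ρ g θ v = ρ g (θ (ρ g⁻¹ v)) := rfl

theorem conj_eq_self_iff (ρ : Representation k Γ V) (g : Γ) (θ : Module.End k V) :
    conj ρ g θ = θ ↔ Commute (ρ g) θ := by
  constructor
  · intro h
    calc ρ g * θ = ρ g * θ * (ρ g⁻¹ * ρ g) := by rw [← map_mul]; simp
      _ = θ * ρ g := by rw [← mul_assoc]; exact congrArg (· * ρ g) h
  · intro h
    rw [conj, h.eq, mul_assoc, ← map_mul]; simp

theorem conj_sum (ρ : Representation k Γ V) (g : Γ) {ι : Type*} (s : Finset ι)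
    (θ : ι → Module.End k V) : conj ρ g (∑ x ∈ s, θ x) = ∑ x ∈ s, conj ρ g (θ x) := by
  simp only [conj, Finset.mul_sum, Finset.sum_mul]

theorem conj_mul_right_invariant {ρ : Representation k Γ V} {H : Subgroup Γ}
    {θ : Module.End k V} (hθ : ∀ h ∈ H, Commute (ρ h) θ) (γ : Γ) (h : Γ) (hh : h ∈ H) :
    conj ρ (γ * h) θ = conj ρ γ θ := by
  rw [conj_mul, (conj_eq_self_iff ρ h θ).2 (hθ h hh)]

/-- The projection of an induced module onto the summand `1 ⊗ W`. -/
noncomputable def indProj (H : Subgroup Γ) (σ : Representation k H W) :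
    Module.End k (Representation.IndV H.subtype σ) :=
  open Classical in
  Representation.Coinvariants.map _ _
    ⟨((MonoidAlgebra.coeffLinearEquiv k).symm.toLinearMap ∘ₗ
      Finsupp.lsum k (fun h : Γ => if h ∈ H then Finsupp.lsingle h else 0) ∘ₗ
      (MonoidAlgebra.coeffLinearEquiv k).toLinearMap).rTensor _, fun g => by
        ext h w
        by_cases hh : h ∈ H <;> simp [hh, H.mul_mem_cancel_left g.2]⟩

theorem indProj_mk (H : Subgroup Γ) (σ : Representation k H W) (h : Γ) (w : W) [Decidable (h ∈ H)] :
    indProj H σ (Representation.IndV.mk H.subtype σ h w) =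
      if h ∈ H then Representation.IndV.mk H.subtype σ h w else 0 := by
  by_cases hh : h ∈ H <;> simp [indProj, hh]

theorem commute_ind_indProj (H : Subgroup Γ) (σ : Representation k H W) {h : Γ} (hh : h ∈ H) :
    Commute (Representation.ind H.subtype σ h) (indProj H σ) := by
  classical
  refine Representation.IndV.hom_ext _ _ fun g => LinearMap.ext fun w => ?_
  change Representation.ind H.subtype σ h (indProj H σ (Representation.IndV.mk _ _ g w)) =
    indProj H σ (Representation.ind H.subtype σ h (Representation.IndV.mk _ _ g w))
  rw [Representation.ind_mk, indProj_mk, indProj_mk, H.mul_mem_cancel_right (H.inv_mem hh)]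
  split_ifs
  · rw [Representation.ind_mk]
  · rw [map_zero]

theorem sum_conj_indProj (H : Subgroup Γ) [Fintype (Γ ⧸ H)] (σ : Representation k H W) :
    ∑ x : Γ ⧸ H, conj (Representation.ind H.subtype σ) x.out (indProj H σ) = 1 := by
  classical
  refine Representation.IndV.hom_ext _ _ fun h => LinearMap.ext fun w => ?_
  change (∑ x : Γ ⧸ H, conj (Representation.ind H.subtype σ) x.out (indProj H σ))
    (Representation.IndV.mk _ _ h w) = Representation.IndV.mk _ _ h w
  rw [LinearMap.sum_apply, Finset.sum_eq_single ((h⁻¹ : Γ) : Γ ⧸ H)]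
  · have hmem : h * ((h⁻¹ : Γ) : Γ ⧸ H).out ∈ H := by
      have := QuotientGroup.eq.1 (QuotientGroup.out_eq' ((h⁻¹ : Γ) : Γ ⧸ H)).symm
      rwa [inv_inv] at this
    rw [conj_apply, Representation.ind_mk, indProj_mk, inv_inv, if_pos hmem,
      Representation.ind_mk, mul_inv_cancel_right]
  · intro x _ hx
    have hmem : h * x.out ∉ H := fun hm => hx <| by
      rw [← QuotientGroup.out_eq' x, eq_comm]
      exact QuotientGroup.eq.2 (by rwa [inv_inv])
    rw [conj_apply, Representation.ind_mk, indProj_mk, inv_inv, if_neg hmem, map_zero]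
  · exact fun h => absurd (Finset.mem_univ _) h

/-- A direct summand of an induced module satisfies Higman's criterion. -/
theorem exists_trace_eq_one_of_isSummand_ind {H : Subgroup Γ} [Fintype (Γ ⧸ H)]
    {σ : Representation k H W} {ρ : Representation k Γ V}
    (h : IsSummand ρ (Representation.ind H.subtype σ)) :
    ∃ θ : Module.End k V, (∀ h ∈ H, Commute (ρ h) θ) ∧
      ∑ x : Γ ⧸ H, conj ρ x.out θ = 1 := by
  obtain ⟨i, q, hqi⟩ := h
  refine ⟨q.toLinearMap ∘ₗ indProj H σ ∘ₗ i.toLinearMap, fun h hh => ?_, ?_⟩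
  · ext v
    change ρ h (q (indProj H σ (i v))) = q (indProj H σ (i (ρ h v)))
    rw [← q.isIntertwining, i.isIntertwining]
    exact congrArg q (LinearMap.congr_fun (commute_ind_indProj H σ hh).eq (i v))
  · ext v
    have key := congrArg q (LinearMap.congr_fun (sum_conj_indProj H σ) (i v))
    rw [Module.End.one_apply, hqi, LinearMap.sum_apply, map_sum] at key
    rw [Module.End.one_apply, LinearMap.sum_apply]
    refine Eq.trans (Finset.sum_congr rfl fun x _ => ?_) key
    change ρ _ (q (indProj H σ (i (ρ _ v)))) = _
    rw [conj_apply, q.isIntertwining, i.isIntertwining]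

/-- Frobenius reciprocity: the map `h ⊗ w ↦ ρ h⁻¹ (f w)` on the induced module. -/
noncomputable def indLift {H : Subgroup Γ} {σ : Representation k H W} {ρ : Representation k Γ V}
    (f : W →ₗ[k] V) (hf : ∀ (h : H) (w : W), f (σ h w) = ρ h (f w)) :
    Representation.IntertwiningMap (Representation.ind H.subtype σ) ρ :=
  ⟨Representation.Coinvariants.lift _
    (TensorProduct.lift <| (Finsupp.lift _ _ _ fun h => ρ h⁻¹ ∘ₗ f) ∘ₗ
      (MonoidAlgebra.coeffLinearEquiv k).toLinearMap)
    fun g => by ext h w; simp [hf], fun g => by ext h w; simp⟩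

theorem indLift_mk {H : Subgroup Γ} {σ : Representation k H W} {ρ : Representation k Γ V}
    (f : W →ₗ[k] V) (hf : ∀ (h : H) (w : W), f (σ h w) = ρ h (f w)) (h : Γ) (w : W) :
    indLift f hf (Representation.IndV.mk H.subtype σ h w) = ρ h⁻¹ (f w) := by
  change (indLift f hf).toLinearMap _ = _
  simp [indLift]

theorem indV_mk_subgroup_mul (H : Subgroup Γ) (σ : Representation k H W) (h : H) (g : Γ) (w : W) :
    Representation.IndV.mk H.subtype σ (h * g) (σ h w) =
      Representation.IndV.mk H.subtype σ g w := by
  simpa using Representation.Coinvariants.mk_self_apply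
    (Representation.tprod ((Representation.leftRegular k Γ).comp H.subtype) σ) h
    (MonoidAlgebra.single g 1 ⊗ₜ w)

/-- A module that satisfies Higman's criterion is relatively projective. -/
theorem isRelProjective_of_trace_eq_one [FiniteDimensional k V] {H : Subgroup Γ}
    [Fintype (Γ ⧸ H)] {ρ : Representation k Γ V} {θ : Module.End k V}
    (hθ : ∀ h ∈ H, Commute (ρ h) θ) (h1 : ∑ x : Γ ⧸ H, conj ρ x.out θ = 1) :
    IsRelProjective H ρ := by
  let e : V ≃ₗ[k] (Fin (Module.finrank k V) → k) := (Module.finBasis k V).equivFun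
  let σ : Representation k H (Fin (Module.finrank k V) → k) :=
    { toFun := fun h => e.toLinearMap ∘ₗ ρ h ∘ₗ e.symm.toLinearMap
      map_one' := by ext; simp
      map_mul' := fun a b => by ext; simp }
  have hσ : ∀ (h : H) v, e (ρ h v) = σ h (e v) := fun h v => by simp [σ]
  refine ⟨_, σ, ?_⟩
  have key : ∀ v γ, ∀ h ∈ H,
      Representation.IndV.mk H.subtype σ (γ * h)⁻¹ (e (θ (ρ (γ * h)⁻¹ v))) =
        Representation.IndV.mk H.subtype σ γ⁻¹ (e (θ (ρ γ⁻¹ v))) := fun v γ h hh => by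
    have h2 : θ (ρ h⁻¹ (ρ γ⁻¹ v)) = ρ h⁻¹ (θ (ρ γ⁻¹ v)) :=
      (LinearMap.congr_fun (hθ h⁻¹ (H.inv_mem hh)).eq _).symm
    rw [mul_inv_rev, map_mul, Module.End.mul_apply, h2]
    have := indV_mk_subgroup_mul H σ (⟨h, hh⟩⁻¹ : H) γ⁻¹ (e (θ (ρ γ⁻¹ v)))
    rw [← hσ] at this
    exact this
  -- in Mathlib's convention `h ⊗ w` is what is usually written `h⁻¹ ⊗ w`
  let i : V →ₗ[k] Representation.IndV H.subtype σ :=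
    ∑ x : Γ ⧸ H, Representation.IndV.mk H.subtype σ x.out⁻¹ ∘ₗ e.toLinearMap ∘ₗ θ ∘ₗ ρ x.out⁻¹
  have hi : ∀ v, i v =
      ∑ x : Γ ⧸ H, Representation.IndV.mk H.subtype σ x.out⁻¹ (e (θ (ρ x.out⁻¹ v))) := fun v => by
    simp only [i, LinearMap.sum_apply]; rfl
  refine ⟨⟨i, fun g => LinearMap.ext fun v => ?_⟩,
    indLift e.symm.toLinearMap fun h w => by simp [σ], fun v => ?_⟩
  · change i (ρ g v) = Representation.ind H.subtype σ g (i v)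
    rw [hi, hi, map_sum]
    refine (sum_out_mul_left (f := fun γ => Representation.IndV.mk H.subtype σ γ⁻¹
      (e (θ (ρ γ⁻¹ (ρ g v))))) (key (ρ g v)) g).symm.trans ?_
    refine Finset.sum_congr rfl fun x _ => ?_
    rw [Representation.ind_mk, mul_inv_rev, map_mul, Module.End.mul_apply]
    congr 4
    rw [← Module.End.mul_apply, ← map_mul, inv_mul_cancel, map_one, Module.End.one_apply]
  · change indLift _ _ (i v) = v
    rw [hi, map_sum]
    have h2 := LinearMap.congr_fun h1 v
    rw [LinearMap.sum_apply, Module.End.one_apply] at h2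
    refine Eq.trans (Finset.sum_congr rfl fun x _ => ?_) h2
    rw [indLift_mk, inv_inv, conj_apply]
    simp

end RelativeTraces

/-! ### Endomorphisms of indecomposable modules -/

section LocalEndomorphisms

variable {k Γ V : Type*} [Field k] [Group Γ] [AddCommGroup V] [Module k V]

theorem isCompl_subrepresentation {ρ : Representation k Γ V} {U U' : Subrepresentation ρ} :
    IsCompl U U' ↔ IsCompl U.toSubmodule U'.toSubmodule := by
  simp only [isCompl_iff, disjoint_iff, codisjoint_iff,
    ← Subrepresentation.toSubmodule_injective.eq_iff, Subrepresentation.toSubmodule_inf,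
    Subrepresentation.toSubmodule_sup]
  rfl

/-- **Fitting's lemma** for an indecomposable representation. -/
theorem isNilpotent_or_isUnit_of_commute [FiniteDimensional k V] {ρ : Representation k Γ V}
    (hρ : IsIndecomposable ρ) {f : Module.End k V} (hf : ∀ g, Commute (ρ g) f) :
    IsNilpotent f ∨ IsUnit f := by
  obtain ⟨n, hn, hc⟩ := ((Filter.eventually_ge_atTop 1).and
    (LinearMap.eventually_isCompl_ker_pow_range_pow f)).exists
  have hfn : ∀ g v, (f ^ n) (ρ g v) = ρ g ((f ^ n) v) := fun g v =>
    (LinearMap.congr_fun ((hf g).pow_right n).eq v).symm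
  let F : Representation.IntertwiningMap ρ ρ := ⟨f ^ n, fun g => LinearMap.ext (hfn g)⟩
  rcases hρ.2 F.ker F.range (isCompl_subrepresentation.2 hc) with h | h
  · right
    have hk : LinearMap.ker (f ^ n) = ⊥ := congrArg Subrepresentation.toSubmodule h
    have : IsUnit (f ^ n) := (LinearMap.isUnit_iff_ker_eq_bot _).2 hk
    exact (isUnit_pow_iff (by omega)).1 this
  · left
    have hk : LinearMap.range (f ^ n) = ⊥ := congrArg Subrepresentation.toSubmodule h
    exact ⟨n, LinearMap.range_eq_bot.1 hk⟩

/-- The endomorphism ring of an indecomposable representation is local. -/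
theorem exists_isUnit_of_isUnit_sum [FiniteDimensional k V] {ρ : Representation k Γ V}
    (hρ : IsIndecomposable ρ) {ι : Type*} (s : Finset ι) (f : ι → Module.End k V)
    (hf : ∀ x ∈ s, ∀ g, Commute (ρ g) (f x)) (hu : IsUnit (∑ x ∈ s, f x)) :
    ∃ x ∈ s, IsUnit (f x) := by
  classical
  have := hρ.1
  induction s using Finset.induction with
  | empty => simp at hu
  | insert a s ha ih =>
    have hf' : ∀ x ∈ s, ∀ g, Commute (ρ g) (f x) := fun x hx => hf x (Finset.mem_insert_of_mem hx)
    obtain ⟨u, hu⟩ := hu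
    have hcu : ∀ g, Commute (ρ g) (u : Module.End k V) := fun g =>
      hu ▸ Commute.sum_right _ _ _ fun x hx => hf x hx g
    -- after division by the sum `u`, the two parts add up to `1`
    rcases isNilpotent_or_isUnit_of_commute hρ (f := ↑u⁻¹ * f a) fun g =>
      ((hcu g).units_inv_right).mul_right (hf a (Finset.mem_insert_self a s) g) with h | h
    · have h1 : (↑u⁻¹ : Module.End k V) * ∑ x ∈ s, f x = 1 - ↑u⁻¹ * f a := by
        rw [eq_sub_iff_add_eq, add_comm, ← mul_add, ← Finset.sum_insert ha, ← hu, Units.inv_mul]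
      have h2 : IsUnit (∑ x ∈ s, f x) := by
        rw [← Units.isUnit_units_mul u⁻¹, h1]
        exact h.isUnit_one_sub
      obtain ⟨x, hx, hxu⟩ := ih hf' h2
      exact ⟨x, Finset.mem_insert_of_mem hx, hxu⟩
    · exact ⟨a, Finset.mem_insert_self a s, (Units.isUnit_units_mul u⁻¹ _).1 h⟩

end LocalEndomorphisms

/-! ### Equivariant families of endomorphisms -/

section EquivariantSums

variable {k Γ V : Type*} [Field k] [Group Γ] [AddCommGroup V] [Module k V]

theorem commute_sum_conj {ρ : Representation k Γ V} {H : Subgroup Γ} [Fintype (Γ ⧸ H)]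
    {θ : Module.End k V} (hθ : ∀ h ∈ H, Commute (ρ h) θ) (g : Γ) :
    Commute (ρ g) (∑ x : Γ ⧸ H, conj ρ x.out θ) := by
  rw [← conj_eq_self_iff, conj_sum]
  simp only [← conj_mul]
  exact sum_out_mul_left (f := fun γ => conj ρ γ θ) (conj_mul_right_invariant hθ) g

variable [FiniteDimensional k V]

theorem isRelProjective_of_isUnit_trace {ρ : Representation k Γ V} {H : Subgroup Γ}
    [Fintype (Γ ⧸ H)] {θ : Module.End k V} (hθ : ∀ h ∈ H, Commute (ρ h) θ)
    (hu : IsUnit (∑ x : Γ ⧸ H, conj ρ x.out θ)) : IsRelProjective H ρ := by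
  obtain ⟨u, hu⟩ := hu
  have hc : ∀ g, Commute (ρ g) (↑u⁻¹ : Module.End k V) := fun g =>
    Commute.units_inv_right (hu ▸ commute_sum_conj hθ g)
  refine isRelProjective_of_trace_eq_one (θ := θ * ↑u⁻¹)
    (fun h hh => (hθ h hh).mul_right (hc h)) ?_
  have : ∀ g, conj ρ g (θ * ↑u⁻¹) = conj ρ g θ * ↑u⁻¹ := fun g => by
    simp only [conj, mul_assoc, (hc g⁻¹).eq]
  simp only [this, ← Finset.sum_mul, ← hu, Units.mul_inv]

/-- Relative to a subgroup over which an indecomposable module is not projective, every trace is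
nilpotent, hence fixes no nonzero vector. -/
theorem eq_zero_of_trace_apply_eq_self {ρ : Representation k Γ V} (hρ : IsIndecomposable ρ)
    {H : Subgroup Γ} [Fintype (Γ ⧸ H)] (hH : ¬ IsRelProjective H ρ) {θ : Module.End k V}
    (hθ : ∀ h ∈ H, Commute (ρ h) θ) {v : V} (hv : (∑ x : Γ ⧸ H, conj ρ x.out θ) v = v) :
    v = 0 := by
  obtain ⟨n, hn⟩ := (isNilpotent_or_isUnit_of_commute hρ (commute_sum_conj hθ)).resolve_right
    fun hu => hH (isRelProjective_of_isUnit_trace hθ hu)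
  have h : ∀ m, ((∑ x : Γ ⧸ H, conj ρ x.out θ) ^ m) v = v := fun m => by
    induction m with
    | zero => rfl
    | succ m ih => rw [pow_succ, Module.End.mul_apply, hv, ih]
  rw [← h n, hn, LinearMap.zero_apply]

/-- An equivariant family of endomorphisms of an indecomposable module that is indexed by a finite
`Γ`-set and has invertible sum: since the sums over the orbits commute with `Γ`, one of them is
invertible, so the module is projective relative to the stabilizers in that orbit. -/
theorem exists_isRelProjective_stabilizer {ρ : Representation k Γ V} (hρ : IsIndecomposable ρ)
    {X : Type*} [Finite Γ] [Fintype X] [MulAction Γ X] (F : X → Module.End k V)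
    (hF : ∀ (g : Γ) x, F (g • x) = conj ρ g (F x)) (hu : IsUnit (∑ x, F x)) :
    ∃ x : X, ∀ g : Γ, IsRelProjective (MulAction.stabilizer Γ (g • x)) ρ := by
  classical
  have := Fintype.ofFinite (MulAction.orbitRel.Quotient Γ X)
  rw [← Finset.sum_fiberwise Finset.univ
    (fun x => (Quotient.mk _ x : MulAction.orbitRel.Quotient Γ X))] at hu
  have horb : ∀ y : X, ∀ [Fintype (Γ ⧸ MulAction.stabilizer Γ y)],
      ∑ x with (Quotient.mk _ x : MulAction.orbitRel.Quotient Γ X) = Quotient.mk _ y, F x =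
        ∑ q : Γ ⧸ MulAction.stabilizer Γ y, conj ρ q.out (F y) := fun y _ => by
    symm
    refine Finset.sum_bij (fun q _ => q.out • y) (fun q _ => ?_) (fun q _ r _ h => ?_)
      (fun x hx => ?_) fun q _ => (hF _ _).symm
    · exact Finset.mem_filter.2 ⟨Finset.mem_univ _, Quotient.sound ⟨q.out, rfl⟩⟩
    · rw [← QuotientGroup.out_eq' q, ← QuotientGroup.out_eq' r]
      refine QuotientGroup.eq.2 ?_
      rw [MulAction.mem_stabilizer_iff, mul_smul, ← h, inv_smul_smul]
    · obtain ⟨g, rfl⟩ := Quotient.exact (Finset.mem_filter.1 hx).2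
      refine ⟨(g : Γ ⧸ MulAction.stabilizer Γ y), Finset.mem_univ _, ?_⟩
      obtain ⟨h, hh⟩ := QuotientGroup.mk_out_eq_mul (MulAction.stabilizer Γ y) g
      rw [hh, mul_smul, h.2]
  have hstab : ∀ y : X, ∀ h ∈ MulAction.stabilizer Γ y, Commute (ρ h) (F y) := fun y h hh => by
    rw [← conj_eq_self_iff, ← hF, hh]
  obtain ⟨ω, -, hω⟩ := exists_isUnit_of_isUnit_sum hρ _ _ (fun ω _ g => by
    obtain ⟨y, rfl⟩ := Quotient.exists_rep ω
    have := Fintype.ofFinite (Γ ⧸ MulAction.stabilizer Γ y)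
    rw [horb]
    exact commute_sum_conj (hstab y) g) hu
  obtain ⟨y, rfl⟩ := Quotient.exists_rep ω
  refine ⟨y, fun g => ?_⟩
  have hgy : (Quotient.mk _ y : MulAction.orbitRel.Quotient Γ X) = Quotient.mk _ (g • y) :=
    (Quotient.sound ⟨g, rfl⟩ : (Quotient.mk _ (g • y) : MulAction.orbitRel.Quotient Γ X) = _).symm
  have := Fintype.ofFinite (Γ ⧸ MulAction.stabilizer Γ (g • y))
  rw [hgy, horb] at hω
  exact isRelProjective_of_isUnit_trace (hstab _) hω

end EquivariantSums

/-! ### Vertices of trivial source modules -/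

section TrivialSource

variable {k Γ V : Type*} [Field k] [Group Γ] [AddCommGroup V] [Module k V]

/-- By locality of the endomorphism ring, a trivial source module is a summand of a single
permutation module `k[Γ/H]`. -/
theorem exists_isSummand_ind_trivial [FiniteDimensional k V] {ρ : Representation k Γ V}
    (hρ : IsTrivialSource ρ) :
    ∃ H : Subgroup Γ,
      IsSummand ρ (Representation.ind H.subtype (Representation.trivial k H k)) := by
  classical
  obtain ⟨hind, r, H, i, q, hqi⟩ := hρ
  let W : Fin r → Type _ := fun j =>
    Representation.IndV (H j).subtype (Representation.trivial k (H j) k)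
  let σ : ∀ j, Representation k Γ (W j) := fun j =>
    Representation.ind (H j).subtype (Representation.trivial k (H j) k)
  let i' : ∀ j, Representation.IntertwiningMap ρ (σ j) := fun j =>
    ⟨DirectSum.component k (Fin r) W j ∘ₗ i.toLinearMap, fun g => LinearMap.ext fun v => by
      change (i (ρ g v)) j = σ j g ((i v) j)
      rw [i.isIntertwining]
      exact DirectSum.lmap_apply _ _ _⟩
  let q' : ∀ j, Representation.IntertwiningMap (σ j) ρ := fun j =>
    ⟨q.toLinearMap ∘ₗ DirectSum.lof k (Fin r) W j, fun g => LinearMap.ext fun v => by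
      change q (DirectSum.lof k (Fin r) W j (σ j g v)) = ρ g (q (DirectSum.lof k (Fin r) W j v))
      rw [← q.isIntertwining]
      exact congrArg q (DirectSum.lmap_lof (fun j => σ j g) j v).symm⟩
  let f : Fin r → Module.End k V := fun j => (q' j).toLinearMap ∘ₗ (i' j).toLinearMap
  have hcomm : ∀ j g, Commute (ρ g) (f j) := fun j g =>
    LinearMap.ext fun v => by
      change ρ g (q' j (i' j v)) = q' j (i' j (ρ g v))
      rw [(i' j).isIntertwining, (q' j).isIntertwining]
  have hsum : ∑ j, f j = 1 := by
    ext v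
    rw [LinearMap.sum_apply, Module.End.one_apply]
    refine Eq.trans ?_ (hqi v)
    refine Eq.trans ?_ (congrArg q (DirectSum.sum_univ_of (i v)))
    rw [map_sum]
    rfl
  obtain ⟨j, -, u, hu⟩ := exists_isUnit_of_isUnit_sum hind Finset.univ f (fun j _ => hcomm j)
    (hsum ▸ isUnit_one)
  refine ⟨H j, i' j, ⟨(↑u⁻¹ : Module.End k V) ∘ₗ (q' j).toLinearMap, fun g => ?_⟩, fun v => ?_⟩
  · have hcu : Commute (ρ g) (↑u⁻¹ : Module.End k V) := Commute.units_inv_right (hu ▸ hcomm j g)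
    refine LinearMap.ext fun w => ?_
    change (↑u⁻¹ : Module.End k V) (q' j (σ j g w)) = ρ g ((↑u⁻¹ : Module.End k V) (q' j w))
    rw [(q' j).isIntertwining]
    exact (LinearMap.congr_fun hcu.eq _).symm
  · have := LinearMap.congr_fun u.inv_mul v
    rw [hu] at this
    exact this

theorem apply_eq_self_of_isSummand_ind_trivial {ρ : Representation k Γ V} {H : Subgroup Γ}
    (h : IsSummand ρ (Representation.ind H.subtype (Representation.trivial k H k))) {d : Γ}
    (hd : d ∈ Subgroup.center Γ) (hdH : d ∈ H) (v : V) : ρ d v = v := by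
  obtain ⟨i, q, hqi⟩ := h
  have h1 : Representation.ind H.subtype (Representation.trivial k H k) d = 1 := by
    refine Representation.IndV.hom_ext _ _ fun g => LinearMap.ext fun w => ?_
    change Representation.ind _ _ d (Representation.IndV.mk _ _ g w) =
      Representation.IndV.mk _ _ g w
    rw [Representation.ind_mk, Subgroup.mem_center_iff.1 (inv_mem hd) g]
    exact indV_mk_subgroup_mul H (Representation.trivial k H k) ⟨d, hdH⟩⁻¹ g w
  rw [← hqi (ρ d v), i.isIntertwining, h1, Module.End.one_apply, hqi]

/-- If an indecomposable module is a summand of a module induced from `H`, then a vertex `Q` is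
conjugate to a subgroup of `H`, so the central elements of `Q` lie in `H`.  The product of the two
trace decompositions of the identity relative to `Q` and `H` is indexed by `Γ/Q × Γ/H`, where the
stabilizers are intersections of conjugates of `Q` and `H`. -/
theorem le_of_isVertex_of_isSummand_ind [FiniteDimensional k V] [Finite Γ]
    {W : Type*} [AddCommGroup W] [Module k W]
    {ρ : Representation k Γ V} (hρ : IsIndecomposable ρ) {Q H D : Subgroup Γ} (hQ : IsVertex Q ρ)
    {σ : Representation k H W} (h : IsSummand ρ (Representation.ind H.subtype σ))
    (hDQ : D ≤ Q) (hD : D ≤ Subgroup.center Γ) : D ≤ H := by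
  have := Fintype.ofFinite (Γ ⧸ Q)
  have := Fintype.ofFinite (Γ ⧸ H)
  obtain ⟨n, τ, hτ⟩ := hQ.prop
  obtain ⟨a, ha, ha1⟩ := exists_trace_eq_one_of_isSummand_ind hτ
  obtain ⟨b, hb, hb1⟩ := exists_trace_eq_one_of_isSummand_ind h
  have hequiv : ∀ {K : Subgroup Γ} {θ : Module.End k V} (hθ : ∀ h ∈ K, Commute (ρ h) θ) (g : Γ)
      (x : Γ ⧸ K), conj ρ (g • x).out θ = conj ρ g (conj ρ x.out θ) := fun hθ g x => by
    conv_lhs => rw [← QuotientGroup.out_eq' x]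
    rw [← conj_mul]
    exact apply_out_eq_of_mul_right_invariant (f := fun γ => conj ρ γ _)
      (conj_mul_right_invariant hθ) (g * x.out)
  obtain ⟨⟨x, y⟩, hxy⟩ := exists_isRelProjective_stabilizer hρ
    (X := (Γ ⧸ Q) × (Γ ⧸ H)) (fun z => conj ρ z.1.out a * conj ρ z.2.out b)
    (fun g z => by
      change conj ρ (g • z.1).out a * conj ρ (g • z.2).out b = _
      rw [hequiv ha, hequiv hb]
      generalize conj ρ z.1.out a = A
      generalize conj ρ z.2.out b = B
      calc ρ g * A * ρ g⁻¹ * (ρ g * B * ρ g⁻¹)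
          = ρ g * A * (ρ g⁻¹ * ρ g) * B * ρ g⁻¹ := by simp only [mul_assoc]
        _ = ρ g * (A * B) * ρ g⁻¹ := by rw [← map_mul]; simp [mul_assoc])
    (by
      have hs := Fintype.sum_mul_sum (fun x : Γ ⧸ Q => conj ρ x.out a)
        (fun y : Γ ⧸ H => conj ρ y.out b)
      rw [ha1, hb1, mul_one, ← Fintype.sum_prod_type'] at hs
      rw [← hs]
      exact isUnit_one)
  obtain ⟨s, rfl⟩ := QuotientGroup.mk_surjective x
  obtain ⟨t, rfl⟩ := QuotientGroup.mk_surjective y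
  have hle : MulAction.stabilizer Γ (s⁻¹ • ((s : Γ ⧸ Q), (t : Γ ⧸ H))) ≤ Q := fun g hg => by
    have h1 : ((g * (s⁻¹ * s) : Γ) : Γ ⧸ Q) = ((s⁻¹ * s : Γ) : Γ ⧸ Q) := congrArg Prod.fst hg
    rw [inv_mul_cancel, mul_one] at h1
    simpa using QuotientGroup.eq.1 h1.symm
  -- the stabilizer is contained in `Q`, hence equal to `Q` by minimality
  intro d hd
  have hds := hQ.le_of_le (hxy s⁻¹) hle (hDQ hd)
  have h2 : ((d * (s⁻¹ * t) : Γ) : Γ ⧸ H) = ((s⁻¹ * t : Γ) : Γ ⧸ H) := congrArg Prod.snd hds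
  have h3 := QuotientGroup.eq.1 h2.symm
  rwa [← Subgroup.mem_center_iff.1 (hD hd), inv_mul_cancel_left] at h3

/-- A central subgroup that lies in a vertex of a trivial source module acts trivially on it. -/
theorem apply_eq_self_of_mem_vertex [FiniteDimensional k V] [Finite Γ]
    {ρ : Representation k Γ V} (hρ : IsTrivialSource ρ)
    {Q D : Subgroup Γ} (hQ : IsVertex Q ρ) (hDQ : D ≤ Q) (hD : D ≤ Subgroup.center Γ)
    {d : Γ} (hd : d ∈ D) (v : V) : ρ d v = v := by
  obtain ⟨H, hH⟩ := exists_isSummand_ind_trivial hρ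
  exact apply_eq_self_of_isSummand_ind_trivial hH (hD hd)
    (le_of_isVertex_of_isSummand_ind hρ.1 hQ hH hDQ hD hd) v

end TrivialSource

/-- A module that is projective relative to a diagonal subgroup is projective on restriction to
`G × 1`: Higman's criterion for the trivial subgroup of `G`. -/
theorem exists_sum_conj_eq_one_of_isRelProjective_diagonalSubgroup
    {k G G' P V : Type*} [Field k] [Group G] [Fintype G] [Group G'] [Finite G'] [Group P]
    [AddCommGroup V] [Module k V]
    {i : P →* G} {i' : P →* G'} (hi' : Function.Injective i') {ρ : Representation k (G × G') V}
    (h : IsRelProjective (diagonalSubgroup i i') ρ) :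
    ∃ θ : Module.End k V, ∑ g : G, conj ρ (g, 1) θ = 1 := by
  rw [diagonalSubgroup] at h
  have := Fintype.ofFinite ((G × G') ⧸ (i.prod i').range)
  have := Fintype.ofFinite (G' ⧸ i'.range)
  obtain ⟨n, τ, hτ⟩ := h
  obtain ⟨a, ha, ha1⟩ := exists_trace_eq_one_of_isSummand_ind hτ
  refine ⟨∑ q : G' ⧸ i'.range, conj ρ (1, q.out) a, Eq.trans ?_ ((sum_out_prod_range i i' hi'
    (f := fun γ => conj ρ γ a) (conj_mul_right_invariant ha)).symm.trans ha1)⟩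
  simp only [conj_sum, ← conj_mul, Prod.mk_mul_mk, mul_one, one_mul]

/-! ### Simple modules -/

section Irreducible

variable {k G V : Type*} [Field k] [Group G] [AddCommGroup V] [Module k V]

theorem eq_bot_or_eq_top_of_irreducible {σ : Representation k G V} (hσ : σ.IsIrreducible)
    (U : Submodule k V) (hU : ∀ g, ∀ v ∈ U, σ g v ∈ U) : U = ⊥ ∨ U = ⊤ := by
  let U' : Subrepresentation σ := ⟨U, fun g v hv => hU g v hv⟩
  rcases hσ.eq_bot_or_eq_top U' with h | h
  · exact Or.inl (congrArg Subrepresentation.toSubmodule h)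
  · exact Or.inr (congrArg Subrepresentation.toSubmodule h)

theorem nontrivial_of_irreducible {σ : Representation k G V} (hσ : σ.IsIrreducible) :
    Nontrivial V := by
  by_contra h
  rw [not_nontrivial_iff_subsingleton] at h
  obtain ⟨U, U', hne⟩ := hσ.toNontrivial
  exact hne (Subrepresentation.toSubmodule_injective (Subsingleton.elim _ _))

theorem isIrreducible_of_forall {σ : Representation k G V} [Nontrivial V]
    (h : ∀ U : Submodule k V, (∀ g, ∀ v ∈ U, σ g v ∈ U) → U = ⊥ ∨ U = ⊤) : σ.IsIrreducible where
  exists_pair_ne := ⟨⊥, ⊤, fun h =>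
    bot_ne_top (α := Submodule k V) (congrArg Subrepresentation.toSubmodule h)⟩
  eq_bot_or_eq_top U := (h U.toSubmodule fun g _ hv => U.apply_mem_toSubmodule g hv).imp
    (fun h => Subrepresentation.toSubmodule_injective h)
    (fun h => Subrepresentation.toSubmodule_injective h)

theorem finiteDimensional_of_irreducible [Finite G] {σ : Representation k G V}
    (hσ : σ.IsIrreducible) : FiniteDimensional k V := by
  have := nontrivial_of_irreducible hσ
  obtain ⟨x, hx⟩ := exists_ne (0 : V)
  rcases eq_bot_or_eq_top_of_irreducible hσ (Submodule.span k (Set.range fun g => σ g x))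
    (fun g v hv => by
      induction hv using Submodule.span_induction with
      | mem v hv =>
        obtain ⟨h, rfl⟩ := hv
        exact Submodule.subset_span ⟨g * h, by simp⟩
      | zero => simp
      | add a b _ _ ha hb => rw [map_add]; exact add_mem ha hb
      | smul c a _ ha => rw [map_smul]; exact Submodule.smul_mem _ c ha) with h | h
  · refine absurd ((Submodule.eq_bot_iff _).1 h x (Submodule.subset_span ⟨1, by simp⟩)) hx
  · exact ⟨h ▸ Submodule.fg_span (Set.finite_range _)⟩

theorem exists_irreducible_subrepresentation [FiniteDimensional k V] [Nontrivial V]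
    (σ : Representation k G V) :
    ∃ U : Subrepresentation σ, U.toRepresentation.IsIrreducible := by
  obtain ⟨U, hU⟩ := exists_minimal_of_wellFoundedLT
    (fun U : Submodule k V => U ≠ ⊥ ∧ ∀ g, ∀ v ∈ U, σ g v ∈ U) ⟨⊤, top_ne_bot, by simp⟩
  have := Submodule.nontrivial_iff_ne_bot.2 hU.prop.1
  refine ⟨⟨U, fun g v hv => hU.prop.2 g v hv⟩, isIrreducible_of_forall (V := U) fun T hT => ?_⟩
  by_cases hb : T = ⊥
  · exact Or.inl hb
  · right
    have hle : T.map U.subtype ≤ U := Submodule.map_subtype_le U T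
    have := hU.le_of_le (y := T.map U.subtype) ⟨by
      rwa [Ne, (Submodule.map_injective_of_injective U.subtype_injective).eq_iff'
        (Submodule.map_bot _)], ?_⟩ hle
    · rw [eq_top_iff]
      rintro ⟨u, hu⟩ -
      obtain ⟨t, ht, htu⟩ := this hu
      rwa [show t = ⟨u, hu⟩ from Subtype.ext htu] at ht
    · rintro g _ ⟨t, ht, rfl⟩
      exact ⟨_, hT g t ht, rfl⟩

/-- A central `p`-element acts trivially on a simple module in characteristic `p`. -/
theorem apply_eq_self_of_irreducible_of_mem_center {p : ℕ} [Fact p.Prime] [CharP k p]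
    {σ : Representation k G V} (hσ : σ.IsIrreducible) {z : G} (hz : z ∈ Subgroup.center G) {n : ℕ}
    (hn : z ^ p ^ n = 1) (v : V) : σ z v = v := by
  have := nontrivial_of_irreducible hσ
  have : CharP (Module.End k V) p := charP_of_injective_algebraMap
    (FaithfulSMul.algebraMap_injective k (Module.End k V)) p
  have hnil : (σ z - 1) ^ p ^ n = 0 := by
    rw [sub_pow_char_pow_of_commute p n (Commute.one_right _), ← map_pow, hn, map_one, one_pow,
      sub_self]
  rcases eq_bot_or_eq_top_of_irreducible hσ (LinearMap.ker (σ z - 1)) (fun g w hw => by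
    rw [LinearMap.mem_ker, LinearMap.sub_apply, Module.End.one_apply, sub_eq_zero] at hw ⊢
    rw [← Module.End.mul_apply, ← map_mul, ← Subgroup.mem_center_iff.1 hz g, map_mul,
      Module.End.mul_apply, hw]) with h | h
  · have hinj : Function.Injective ⇑((σ z - 1 : Module.End k V) ^ p ^ n) := by
      rw [Module.End.coe_pow]
      exact (LinearMap.ker_eq_bot.1 h).iterate _
    rw [hnil] at hinj
    exact absurd (hinj (a₁ := exists_ne (0 : V) |>.choose) (a₂ := 0) rfl)
      (exists_ne (0 : V)).choose_spec
  · have : v ∈ LinearMap.ker (σ z - 1) := h ▸ Submodule.mem_top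
    simpa [sub_eq_zero] using this

/-- **Burnside's theorem**: over an algebraically closed field, the operators of an irreducible
representation span the whole endomorphism algebra. -/
theorem eq_top_of_forall_mem_of_irreducible [IsAlgClosed k] [FiniteDimensional k V]
    {σ : Representation k G V} (hσ : σ.IsIrreducible) (A : Submodule k (Module.End k V))
    (hA : ∀ g, σ g ∈ A) : A = ⊤ := by
  have hmem : ∀ a : k[G], σ.asAlgebraHom a ∈ A := fun a => by
    induction a using MonoidAlgebra.induction_linear with
    | zero => rw [map_zero]; exact A.zero_mem
    | add x y hx hy => rw [map_add]; exact A.add_mem hx hy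
    | single g a =>
      rw [Representation.asAlgebraHom_single]
      exact A.smul_mem a (hA g)
  rw [eq_top_iff]
  rintro T -
  have := hσ
  have hschur : ∀ f : Module.End k[G] σ.asModule, ∃ c : k, ∀ v, f v = c • v := fun f => by
    obtain ⟨c, hc⟩ := (IsSimpleModule.algebraMap_end_bijective_of_isAlgClosed
      (A := k[G]) (V := σ.asModule) k).2 f
    exact ⟨c, fun v => by rw [← hc]; rfl⟩
  let T' : Module.End k σ.asModule := T
  -- by Schur's lemma, every `k`-linear `T` commutes with the `kG`-endomorphisms
  let f : Module.End (Module.End k[G] σ.asModule) σ.asModule :=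
    { toFun := T'
      map_add' := T'.map_add
      map_smul' := fun g v => by
        obtain ⟨c, hc⟩ := hschur g
        change T' (g v) = g (T' v)
        rw [hc, hc, map_smul] }
  classical
  let b := Module.finBasis k V
  obtain ⟨a, ha⟩ := jacobson_density f (Finset.univ.image b)
  have haT : σ.asAlgebraHom a = T := b.ext fun j =>
    (ha (b j) (Finset.mem_image_of_mem _ (Finset.mem_univ j))).symm
  exact haT ▸ hmem a

theorem isIrreducible_dual [IsAlgClosed k] [FiniteDimensional k V] {σ : Representation k G V}
    (hσ : σ.IsIrreducible) : σ.dual.IsIrreducible := by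
  have := nontrivial_of_irreducible hσ
  refine isIrreducible_of_forall fun U hU => or_iff_not_imp_left.2 fun hne => ?_
  obtain ⟨w, hw, hw0⟩ := U.ne_bot_iff.1 hne
  obtain ⟨v, hv⟩ : ∃ v, w v ≠ 0 := by
    by_contra! h
    exact hw0 (LinearMap.ext h)
  have hA := eq_top_of_forall_mem_of_irreducible hσ
    (U.comap (LinearMap.llcomp k V V k w)) fun g => by
      have h := hU g⁻¹ w hw
      rw [Representation.dual_apply, inv_inv] at h
      exact h
  rw [eq_top_iff]
  rintro μ -
  have : μ.smulRight ((w v)⁻¹ • v) ∈ U.comap (LinearMap.llcomp k V V k w) :=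
    hA ▸ Submodule.mem_top
  have hμ : w ∘ₗ μ.smulRight ((w v)⁻¹ • v) = μ := by
    ext x
    simp [hv]
  exact hμ ▸ this

/-- Over an algebraically closed field, the outer tensor product of two simple modules is simple. -/
theorem eq_bot_or_eq_top_of_tensorProduct [IsAlgClosed k] [FiniteDimensional k V]
    {G' W : Type*} [Group G'] [AddCommGroup W] [Module k W] [FiniteDimensional k W]
    {σ : Representation k G V} (hσ : σ.IsIrreducible)
    {τ : Representation k G' W} (hτ : τ.IsIrreducible) (K : Submodule k (V ⊗[k] W))
    (hKσ : ∀ g, ∀ t ∈ K, (σ g).rTensor W t ∈ K) (hKτ : ∀ g, ∀ t ∈ K, (τ g).lTensor V t ∈ K) :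
    K = ⊥ ∨ K = ⊤ := by
  refine or_iff_not_imp_left.2 fun hne => ?_
  obtain ⟨t, ht, ht0⟩ := K.ne_bot_iff.1 hne
  have hA : ∀ t ∈ K, ∀ T : Module.End k V, T.rTensor W t ∈ K := fun t ht T => by
    have := eq_top_of_forall_mem_of_irreducible hσ
      (K.comap ((LinearMap.applyₗ t).comp (LinearMap.rTensorHom W))) fun g => hKσ g t ht
    exact this.ge (Submodule.mem_top (x := T))
  have hB : ∀ t ∈ K, ∀ T : Module.End k W, T.lTensor V t ∈ K := fun t ht T => by
    have := eq_top_of_forall_mem_of_irreducible hτ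
      (K.comap ((LinearMap.applyₗ t).comp (LinearMap.lTensorHom V))) fun g => hKτ g t ht
    exact this.ge (Submodule.mem_top (x := T))
  let b := Module.finBasis k V
  let c := Module.finBasis k W
  obtain ⟨⟨i, j⟩, hij⟩ : ∃ ij, (b.tensorProduct c).repr t ij ≠ 0 := by
    by_contra! h
    exact ht0 ((b.tensorProduct c).repr.map_eq_zero_iff.1 (Finsupp.ext h))
  have key : ∀ (v : V) (w : W) (s : V ⊗[k] W),
      ((b.coord i).smulRight v).rTensor W (((c.coord j).smulRight w).lTensor V s) =
        (b.tensorProduct c).repr s (i, j) • (v ⊗ₜ[k] w) := fun v w s => by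
    induction s with
    | zero => simp
    | add x y hx hy => simp only [map_add, hx, hy, Finsupp.add_apply, add_smul]
    | tmul x y =>
      simp [TensorProduct.smul_tmul', TensorProduct.tmul_smul, smul_smul]
  rw [eq_top_iff, ← TensorProduct.span_tmul_eq_top, Submodule.span_le]
  rintro _ ⟨v, w, rfl⟩
  have h1 := hA _ (hB _ ht ((c.coord j).smulRight w)) ((b.coord i).smulRight v)
  rw [key] at h1
  exact (K.smul_mem_iff hij).1 h1

end Irreducible

/-! ### Traces of rank one operators -/

section RankOne

variable {k Γ V Y : Type*} [Field k] [AddCommGroup V] [Module k V] [AddCommGroup Y] [Module k Y]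

/-- An endomorphism of a finite-dimensional space is a sum of operators of rank one, so a nonzero
value of `∑ A φ B` is already seen by one of them. -/
theorem exists_rankOne_sum_ne_zero [FiniteDimensional k V] {ι : Type*} [Fintype ι]
    (φ : Module.End k V) (A : ι → Module.End k V) (w : ι → V)
    (h : ∑ x, A x (φ (w x)) ≠ 0) :
    ∃ (l : Module.Dual k V) (n : V), ∑ x, l (w x) • A x n ≠ 0 := by
  by_contra! hz
  let b := Module.finBasis k V
  apply h
  calc ∑ x, A x (φ (w x)) = ∑ x, ∑ t, (b.coord t ∘ₗ φ) (w x) • A x (b t) := by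
        refine Finset.sum_congr rfl fun x _ => ?_
        conv_lhs => rw [← b.sum_repr (φ (w x)), map_sum]
        simp only [map_smul]
        rfl
    _ = 0 := by
        rw [Finset.sum_comm]
        exact Finset.sum_eq_zero fun t _ => hz _ _

/-- Let `Y` be simple and let `M` be indecomposable and not `H`-projective.  If the sum below were
nonzero, then as a function of `y` it would embed `Y` in `M`; extending `χ` along this embedding
to a functional `ν` on `M`, the trace of the rank one operator `ν(-) m` would be the identity on the
image of `Y`, although it is nilpotent. -/
theorem sum_out_smul_eq_zero [Group Γ] {M : Type*} [AddCommGroup M] [Module k M]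
    [FiniteDimensional k M] {ρ : Representation k Γ M} (hρ : IsIndecomposable ρ)
    {H : Subgroup Γ} [Fintype (Γ ⧸ H)] (hH : ¬ IsRelProjective H ρ)
    (hM : ∀ h ∈ H, ρ h = 1) {π : Representation k Γ Y} (hπ : π.IsIrreducible)
    (hY : ∀ h ∈ H, π h = 1) (χ : Module.Dual k Y) (y : Y) (m : M) :
    ∑ x : Γ ⧸ H, χ (π x.out⁻¹ y) • ρ x.out m = 0 := by
  let c : Y →ₗ[k] M := ∑ x : Γ ⧸ H, (χ ∘ₗ π x.out⁻¹).smulRight (ρ x.out m)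
  have hc : ∀ y, c y = ∑ x : Γ ⧸ H, χ (π x.out⁻¹ y) • ρ x.out m := fun y => by
    simp [c, LinearMap.sum_apply]
  rw [← hc]
  have hequiv : ∀ g y, c (π g y) = ρ g (c y) := fun g y => by
    rw [hc, hc, map_sum]
    refine (sum_out_mul_left (f := fun γ => χ (π γ⁻¹ (π g y)) • ρ γ m) (fun γ h hh => ?_)
      g).symm.trans (Finset.sum_congr rfl fun x _ => ?_)
    · simp only [mul_inv_rev, map_mul, hM h hh, hY h⁻¹ (inv_mem hh), one_mul, mul_one]
    · rw [map_smul, map_mul, Module.End.mul_apply, ← Module.End.mul_apply, ← map_mul, mul_inv_rev,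
        inv_mul_cancel_right]
  rcases eq_bot_or_eq_top_of_irreducible hπ (LinearMap.ker c) (fun g v hv => by
    rw [LinearMap.mem_ker] at hv ⊢; rw [hequiv, hv, map_zero]) with h | h
  · obtain ⟨l, hl⟩ := c.exists_leftInverse_of_injective h
    have hl' : ∀ y, l (c y) = y := LinearMap.congr_fun hl
    refine eq_zero_of_trace_apply_eq_self hρ hH (θ := (χ ∘ₗ l).smulRight m)
      (fun h hh => hM h hh ▸ Commute.one_left _) ?_
    rw [LinearMap.sum_apply]
    refine Eq.trans (Finset.sum_congr rfl fun x _ => ?_) (hc y).symm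
    rw [conj_apply, ← hequiv]
    simp [hl']
  · exact LinearMap.mem_ker.1 (h ▸ Submodule.mem_top)

end RankOne

/-! ### The tensor product over the group algebra -/

section TensorOver

variable {k G G' S M : Type*} [Field k] [Group G] [Group G'] [AddCommGroup S] [Module k S]
  [AddCommGroup M] [Module k M] (σ : Representation k G S) (ρ : Representation k (G × G') M)

/-- The element `s ⊗ m` of `S ⊗_{kG} M`. -/
abbrev tensorMk : (S ⊗[k] M) →ₗ[k] TensorOver σ ρ := (balancedRelations σ ρ).mkQ

theorem tensorMk_rTensor (g : G) (t : S ⊗[k] M) :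
    tensorMk σ ρ ((σ g⁻¹).rTensor M t) = tensorMk σ ρ ((ρ (g, 1)).lTensor S t) := by
  induction t with
  | zero => simp
  | add x y hx hy => simp only [map_add, hx, hy]
  | tmul s m =>
    rw [← sub_eq_zero, ← map_sub]
    exact (Submodule.Quotient.mk_eq_zero _).2 (Submodule.subset_span ⟨s, g, m, rfl⟩)

/-- The map `s ⊗ m ↦ ∑ μ(g s) g m` from `S ⊗_{kG} M` to `M` attached to a functional `μ` on `S`. -/
noncomputable def contract [Fintype G] (μ : Module.Dual k S) : TensorOver σ ρ →ₗ[k] M :=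
  (balancedRelations σ ρ).liftQ
    (∑ g : G, TensorProduct.lid k M ∘ₗ TensorProduct.map (μ ∘ₗ σ g) (ρ (g, 1))) <| by
      refine Submodule.span_le.2 ?_
      rintro _ ⟨s, g, m, rfl⟩
      rw [SetLike.mem_coe, LinearMap.mem_ker, map_sub, sub_eq_zero, LinearMap.sum_apply,
        LinearMap.sum_apply]
      refine Fintype.sum_equiv (Equiv.mulRight g⁻¹) _ _ fun h => ?_
      have h1 : ρ (h * g⁻¹, 1) (ρ (g, 1) m) = ρ (h, 1) m := by
        rw [← Module.End.mul_apply, ← map_mul]; simp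
      simp [h1]

theorem contract_tmul [Fintype G] (μ : Module.Dual k S) (s : S) (m : M) :
    contract σ ρ μ (tensorMk σ ρ (s ⊗ₜ m)) = ∑ g : G, μ (σ g s) • ρ (g, 1) m := by
  refine (LinearMap.sum_apply _ _ _).trans (Finset.sum_congr rfl fun g _ => ?_)
  simp

theorem contract_tensorOver [Fintype G] (μ : Module.Dual k S) (g' : G') (n : TensorOver σ ρ) :
    contract σ ρ μ (tensorOver σ ρ g' n) = ρ (1, g') (contract σ ρ μ n) := by
  obtain ⟨t, rfl⟩ := Submodule.mkQ_surjective _ n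
  induction t with
  | zero => simp
  | add x y hx hy => simp only [map_add, hx, hy]
  | tmul s m =>
    have h1 : tensorOver σ ρ g' (tensorMk σ ρ (s ⊗ₜ m)) = tensorMk σ ρ (s ⊗ₜ ρ (1, g') m) := rfl
    rw [h1, contract_tmul, contract_tmul, map_sum]
    refine Finset.sum_congr rfl fun g _ => ?_
    rw [map_smul, ← Module.End.mul_apply, ← Module.End.mul_apply, ← map_mul, ← map_mul]
    simp

/-- If `M` is projective over `kG`, the norm map embeds `S ⊗_{kG} M`, the coinvariants of `S ⊗ M`,
in `S ⊗ M`, so that the contractions separate the points of `S ⊗_{kG} M`. -/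
theorem eq_zero_of_forall_contract_eq_zero [Fintype G] {θ : Module.End k M}
    (hθ : ∑ g : G, conj ρ (g, 1) θ = 1) (n : TensorOver σ ρ)
    (h : ∀ μ, contract σ ρ μ n = 0) : n = 0 := by
  obtain ⟨t, rfl⟩ := Submodule.mkQ_surjective _ n
  -- the coordinates of the norm of `t` in a basis of `S` are contractions
  have hnorm : ∑ g : G, TensorProduct.map (σ g) (ρ (g, 1)) t = 0 := by
    classical
    let b := Module.Basis.ofVectorSpace k S
    refine (TensorProduct.equivFinsuppOfBasisLeft b).map_eq_zero_iff.1 (Finsupp.ext fun j => ?_)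
    rw [Finsupp.zero_apply, ← h (b.coord j)]
    have : ∀ t, (TensorProduct.equivFinsuppOfBasisLeft b)
        (∑ g : G, TensorProduct.map (σ g) (ρ (g, 1)) t) j =
          contract σ ρ (b.coord j) (tensorMk σ ρ t) := fun t => by
      induction t with
      | zero => simp
      | add x y hx hy =>
        simp only [map_add, Finset.sum_add_distrib, Finsupp.add_apply, hx, hy]
      | tmul s m =>
        rw [contract_tmul]
        simp [Finsupp.finsetSum_apply]
    exact this t
  have h1 : ∀ g : G, tensorMk σ ρ ((conj ρ (g, 1) θ).lTensor S t) =
      tensorMk σ ρ (θ.lTensor S (TensorProduct.map (σ g⁻¹) (ρ (g⁻¹, 1)) t)) := fun g => by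
    have : (conj ρ (g, 1) θ).lTensor S t =
        (ρ (g, 1)).lTensor S ((θ ∘ₗ ρ (g⁻¹, 1)).lTensor S t) := by
      rw [← LinearMap.comp_apply, ← LinearMap.lTensor_comp]
      simp [conj, Module.End.mul_eq_comp, LinearMap.comp_assoc]
    rw [this, ← tensorMk_rTensor, ← LinearMap.comp_apply (LinearMap.rTensor M _),
      LinearMap.rTensor_comp_lTensor, ← LinearMap.comp_apply (LinearMap.lTensor S θ),
      LinearMap.lTensor_comp_map]
  calc tensorMk σ ρ t = tensorMk σ ρ ((1 : Module.End k M).lTensor S t) := by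
        rw [Module.End.one_eq_id, LinearMap.lTensor_id, LinearMap.id_apply]
    _ = ∑ g : G, tensorMk σ ρ (θ.lTensor S (TensorProduct.map (σ g⁻¹) (ρ (g⁻¹, 1)) t)) := by
        rw [← hθ, ← LinearMap.coe_lTensorHom, map_sum, LinearMap.sum_apply, map_sum]
        exact Finset.sum_congr rfl fun g _ => h1 g
    _ = tensorMk σ ρ (θ.lTensor S (∑ g : G, TensorProduct.map (σ g) (ρ (g, 1)) t)) := by
        rw [map_sum, map_sum]
        exact Fintype.sum_equiv (Equiv.inv G) _ _ fun g => rfl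
    _ = 0 := by rw [hnorm, map_zero, map_zero]

end TensorOver

/-! ### Socles -/

section Semisimple

universe u

variable {k G : Type*} {S : Type u} [Field k] [Group G] [AddCommGroup S] [Module k S]

/-- The representation is spanned by the images of simple modules, that is, it is semisimple.  The
simple modules are arbitrary types with a map to `S`, rather than submodules, so that the socle of a
module and a simple module itself are covered without transport. -/
def IsSpannedBySimples (σ : Representation k G S) : Prop :=
  Submodule.span k {s : S | ∃ (T : Type u) (_ : AddCommGroup T) (_ : Module k T)
    (τ : Representation k G T) (f : Representation.IntertwiningMap τ σ),
    τ.IsIrreducible ∧ ∃ t, f t = s} = ⊤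

theorem isSpannedBySimples_of_irreducible {σ : Representation k G S} (hσ : σ.IsIrreducible) :
    IsSpannedBySimples σ := by
  refine eq_top_iff.2 fun s _ => Submodule.subset_span ?_
  exact ⟨S, _, _, σ, Representation.IntertwiningMap.id σ, hσ, s, rfl⟩

theorem isSpannedBySimples_socle (σ : Representation k G S) :
    IsSpannedBySimples (socle σ).toRepresentation := by
  suffices h : (socle σ).toSubmodule ≤ (Submodule.span k _).map (socle σ).toSubmodule.subtype by
    refine eq_top_iff.2 fun s _ => ?_
    obtain ⟨s', hs', h'⟩ := h s.2
    exact Subtype.ext h' ▸ hs'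
  refine iSup_le fun U s hs => ?_
  have hle : U.1.toSubmodule ≤ (socle σ).toSubmodule :=
    le_iSup (fun U : {U : Subrepresentation σ // U.toRepresentation.IsIrreducible} =>
      U.1.toSubmodule) U
  refine ⟨⟨s, hle hs⟩, Submodule.subset_span ?_, rfl⟩
  exact ⟨U.1.toSubmodule, _, _, U.1.toRepresentation,
    ⟨Submodule.inclusion hle, fun g => rfl⟩, U.2, ⟨s, hs⟩, rfl⟩

/-- The image of a simple module lies in the socle. -/
theorem mem_socle_of_irreducible {T : Type*} [AddCommGroup T] [Module k T]
    {τ : Representation k G T} (hτ : τ.IsIrreducible) {σ : Representation k G S}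
    (f : Representation.IntertwiningMap τ σ) (t : T) : f t ∈ (socle σ).toSubmodule := by
  by_cases h0 : f t = 0
  · rw [h0]; exact Submodule.zero_mem _
  have hirr : f.range.toRepresentation.IsIrreducible := by
    have : Nontrivial f.range.toSubmodule := ⟨⟨f t, t, rfl⟩, 0, fun h => h0 (congrArg Subtype.val h)⟩
    refine isIrreducible_of_forall fun U hU => ?_
    let r : T →ₗ[k] f.range.toSubmodule := f.toLinearMap.codRestrict _ fun t => ⟨t, rfl⟩
    have hsurj : Function.Surjective r := by
      rintro ⟨_, v, rfl⟩
      exact ⟨v, rfl⟩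
    rcases eq_bot_or_eq_top_of_irreducible hτ (U.comap r)
      (fun g v hv => by
        have h1 := hU g _ hv
        have h2 : r (τ g v) = f.range.toRepresentation g (r v) :=
          Subtype.ext (f.isIntertwining _ _ g v)
        rw [Submodule.mem_comap, h2]
        exact h1) with h | h
    · left
      rw [← Submodule.map_comap_eq_of_surjective hsurj U, h, Submodule.map_bot]
    · right
      rw [← Submodule.map_comap_eq_of_surjective hsurj U, h, Submodule.map_top,
        LinearMap.range_eq_top.2 hsurj]
  exact Submodule.mem_iSup_of_mem
    (p := fun U : {U : Subrepresentation σ // U.toRepresentation.IsIrreducible} =>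
      U.1.toSubmodule) ⟨f.range, hirr⟩ ⟨t, rfl⟩

end Semisimple

theorem finiteDimensional_of_isRelProjective {k Γ V : Type*} [Field k] [Group Γ] [Finite Γ]
    [AddCommGroup V] [Module k V] {H : Subgroup Γ} {ρ : Representation k Γ V}
    (h : IsRelProjective H ρ) : FiniteDimensional k V := by
  obtain ⟨n, σ, i, q, hqi⟩ := h
  have : FiniteDimensional k k[Γ] :=
    Module.Finite.equiv (MonoidAlgebra.coeffLinearEquiv k).symm
  have hsurj : Function.Surjective q.toLinearMap := fun v => ⟨i v, hqi v⟩
  exact Module.Finite.of_surjective _ hsurj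

/-! ### Outer tensor products -/

section OuterTensor

variable {k G G' V W : Type*} [Field k] [Group G] [Group G'] [AddCommGroup V] [Module k V]
  [AddCommGroup W] [Module k W]

/-- The outer tensor product: the representation of `G × G'` on `V ⊗ W`. -/
noncomputable def outerTensor (σ : Representation k G V) (τ : Representation k G' W) :
    Representation k (G × G') (V ⊗[k] W) :=
  Representation.tprod (σ.comp (MonoidHom.fst G G')) (τ.comp (MonoidHom.snd G G'))

theorem outerTensor_apply (σ : Representation k G V) (τ : Representation k G' W) (g : G) (g' : G') :
    outerTensor σ τ (g, g') = TensorProduct.map (σ g) (τ g') := rfl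

theorem isIrreducible_outerTensor [IsAlgClosed k] [FiniteDimensional k V] [FiniteDimensional k W]
    {σ : Representation k G V} (hσ : σ.IsIrreducible)
    {τ : Representation k G' W} (hτ : τ.IsIrreducible) : (outerTensor σ τ).IsIrreducible := by
  have := nontrivial_of_irreducible hσ
  have := nontrivial_of_irreducible hτ
  have : Nontrivial (V ⊗[k] W) := Module.FaithfullyFlat.lTensor_nontrivial k V W
  refine isIrreducible_of_forall fun K hK => eq_bot_or_eq_top_of_tensorProduct hσ hτ K
    (fun g t ht => ?_) fun g t ht => ?_
  · have := hK (g, 1) t ht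
    rwa [outerTensor_apply, map_one, Module.End.one_eq_id] at this
  · have := hK (1, g) t ht
    rwa [outerTensor_apply, map_one, Module.End.one_eq_id] at this

end OuterTensor

/-! ### Matrix coefficients in the regular module -/

section RegularSocle

variable {k G G' V M : Type*} [Field k] [Group G] [Group G'] [AddCommGroup V]
  [Module k V] [AddCommGroup M] [Module k M]

/-- The matrix coefficients `∑ μ(g⁻¹ x) g` of a fixed vector `x`, as an equivariant map from the
dual of `V` to the right regular module. -/
noncomputable def matrixCoefficients [Fintype G] (τ : Representation k G V) (x : V) :
    Representation.IntertwiningMap τ.dual (rightRegular k G) :=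
  ⟨∑ g : G, (Module.Dual.eval k V (τ g⁻¹ x)).smulRight (MonoidAlgebra.single g 1),
    fun h => LinearMap.ext fun μ => by
      change (∑ g : G, (Module.Dual.eval k V (τ g⁻¹ x)).smulRight _) (τ.dual h μ) =
        (∑ g : G, (Module.Dual.eval k V (τ g⁻¹ x)).smulRight _) μ * MonoidAlgebra.single h⁻¹ 1
      rw [LinearMap.sum_apply, LinearMap.sum_apply, Finset.sum_mul]
      refine Fintype.sum_equiv (Equiv.mulRight h) _ _ fun g => ?_
      have h1 : τ.dual h μ (τ g⁻¹ x) = μ (τ (g * h)⁻¹ x) := by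
        rw [mul_inv_rev, map_mul]; rfl
      rw [LinearMap.smulRight_apply, LinearMap.smulRight_apply, Module.Dual.eval_apply,
        Module.Dual.eval_apply, h1, smul_mul_assoc, MonoidAlgebra.single_mul_single]
      simp⟩

theorem matrixCoefficients_apply [Fintype G] (τ : Representation k G V) (x : V)
    (μ : Module.Dual k V) :
    matrixCoefficients τ x μ = ∑ g : G, μ (τ g⁻¹ x) • MonoidAlgebra.single g (1 : k) := by
  refine (LinearMap.sum_apply _ _ _).trans (Finset.sum_congr rfl fun g _ => ?_)
  simp

/-- For a right module `S` over `kG` with a map `ι` to `kG`, the multiplication map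
`s ⊗ m ↦ ι(s) m` from `S ⊗_{kG} M` to `M`. -/
noncomputable def tensorOverMul {S : Type*} [AddCommGroup S] [Module k S] {σ : Representation k G S}
    (ι : Representation.IntertwiningMap σ (rightRegular k G)) (ρ : Representation k (G × G') M) :
    TensorOver σ ρ →ₗ[k] M :=
  (balancedRelations σ ρ).liftQ
    (TensorProduct.lift ((Representation.asAlgebraHom (ρ.comp (MonoidHom.inl G G'))).toLinearMap ∘ₗ
      ι.toLinearMap)) <| by
    refine Submodule.span_le.2 ?_
    rintro _ ⟨s, g, m, rfl⟩
    have h1 : ι (σ g⁻¹ s) = ι s * MonoidAlgebra.single g 1 := by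
      rw [ι.isIntertwining]
      change ι s * MonoidAlgebra.single g⁻¹⁻¹ 1 = _
      rw [inv_inv]
    rw [SetLike.mem_coe, LinearMap.mem_ker, map_sub, sub_eq_zero, TensorProduct.lift.tmul,
      TensorProduct.lift.tmul]
    change Representation.asAlgebraHom _ (ι (σ g⁻¹ s)) m =
      Representation.asAlgebraHom _ (ι s) (ρ (g, 1) m)
    rw [h1, map_mul, Module.End.mul_apply, Representation.asAlgebraHom_single_one]
    rfl

theorem tensorOverMul_tmul {S : Type*} [AddCommGroup S] [Module k S] {σ : Representation k G S}
    (ι : Representation.IntertwiningMap σ (rightRegular k G)) (ρ : Representation k (G × G') M)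
    (s : S) (m : M) : tensorOverMul ι ρ (tensorMk σ ρ (s ⊗ₜ m)) =
      Representation.asAlgebraHom (ρ.comp (MonoidHom.inl G G')) (ι s) m := rfl

end RegularSocle

/-! ### Relatively projective summands of the tensor product -/

section Summands

variable {p : ℕ} {k G G' M Q : Type*} [Field k] [IsAlgClosed k] [Fact p.Prime] [CharP k p]
  [Group G] [Fintype G] [Group G'] [Group Q] [AddCommGroup M] [Module k M]
  [FiniteDimensional k M]

/-- On `S ⊗_{kG} M`, the elements `∑ χ(q⁻¹ x) q` of `kG'` that come from a simple `kG'`-module `T`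
act as zero: composed with a contraction, such an element becomes a matrix coefficient sum of the
simple `k[G × G']`-module `V* ⊗ T`, where `V` is a simple constituent of `S`. -/
theorem sum_smul_tensorOver_eq_zero [Finite G']
    {ρ : Representation k (G × G') M} (hρ : IsIndecomposable ρ)
    {θ : Module.End k M} (hθ : ∑ g : G, conj ρ (g, 1) θ = 1)
    (hQ : IsPGroup p Q) {j : Q →* G} {j' : Q →* G'} (hj' : Function.Injective j')
    (hjc : j.range ≤ Subgroup.center G) (hjc' : j'.range ≤ Subgroup.center G')
    (hQM : ∀ u, ρ (j u, j' u) = 1) (hproj : ¬ IsRelProjective (j.prod j').range ρ)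
    {S : Type*} [AddCommGroup S] [Module k S] {σ : Representation k G S}
    (hσ : IsSpannedBySimples σ) [Fintype (G' ⧸ j'.range)]
    {T : Type*} [AddCommGroup T] [Module k T] {τ : Representation k G' T} (hτ : τ.IsIrreducible)
    (χ : Module.Dual k T) (x : T) (n : TensorOver σ ρ) :
    ∑ q : G' ⧸ j'.range, χ (τ q.out⁻¹ x) • tensorOver σ ρ q.out n = 0 := by
  have := Fintype.ofFinite ((G × G') ⧸ (j.prod j').range)
  refine eq_zero_of_forall_contract_eq_zero σ ρ hθ _ fun μ => ?_
  simp only [map_sum, map_smul, contract_tensorOver]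
  let L : TensorOver σ ρ →ₗ[k] M := ∑ q : G' ⧸ j'.range,
    χ (τ q.out⁻¹ x) • (ρ (1, q.out) ∘ₗ contract σ ρ μ)
  suffices hL : L = 0 by
    have := LinearMap.congr_fun hL n
    simpa [L, LinearMap.sum_apply] using this
  refine Submodule.linearMap_qext _ (TensorProduct.ext (LinearMap.ext_on hσ ?_))
  rintro _ ⟨V, _, _, π, f, hπ, v, rfl⟩
  ext m
  have : FiniteDimensional k V := finiteDimensional_of_irreducible hπ
  have : FiniteDimensional k T := finiteDimensional_of_irreducible hτ
  have hπd := isIrreducible_dual hπ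
  let ω := outerTensor π.dual τ
  have hωQ : ∀ u, ω (j u, j' u) = 1 := fun u => by
    obtain ⟨a, ha⟩ := hQ u
    have h1 : π.dual (j u) = 1 := LinearMap.ext fun v =>
      apply_eq_self_of_irreducible_of_mem_center hπd (hjc ⟨u, rfl⟩) (p := p) (n := a)
        (by rw [← map_pow, ha, map_one]) v
    have h2 : τ (j' u) = 1 := LinearMap.ext fun v =>
      apply_eq_self_of_irreducible_of_mem_center hτ (hjc' ⟨u, rfl⟩) (p := p) (n := a)
        (by rw [← map_pow, ha, map_one]) v
    rw [outerTensor_apply, h1, h2]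
    exact TensorProduct.map_one
  -- evaluation at `v` on `V*`, tensored with `χ`
  let ev : Module.Dual k (Module.Dual k V ⊗[k] T) :=
    TensorProduct.lid k k ∘ₗ TensorProduct.map (Module.Dual.eval k V v) χ
  have hzero := sum_out_smul_eq_zero hρ hproj (by rintro _ ⟨u, rfl⟩; exact hQM u)
    (isIrreducible_outerTensor hπd hτ) (by rintro _ ⟨u, rfl⟩; exact hωQ u)
    ev ((μ ∘ₗ f.toLinearMap) ⊗ₜ x) m
  rw [sum_out_prod_range j j' hj' (f := fun γ => ev (ω γ⁻¹ ((μ ∘ₗ f.toLinearMap) ⊗ₜ x)) • ρ γ m)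
    (by
      rintro γ _ ⟨u, rfl⟩
      have h1 : ω (j.prod j' u)⁻¹ = 1 := by rw [← map_inv]; exact hωQ u⁻¹
      have h2 : ρ (j.prod j' u) = 1 := hQM u
      rw [mul_inv_rev, map_mul, map_mul, h1, h2, one_mul, mul_one]), Finset.sum_comm] at hzero
  refine Eq.trans ?_ hzero
  change L (tensorMk σ ρ (f v ⊗ₜ m)) = _
  rw [LinearMap.sum_apply]
  refine Finset.sum_congr rfl fun q _ => ?_
  rw [LinearMap.smul_apply, LinearMap.comp_apply, contract_tmul, map_sum, Finset.smul_sum]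
  refine Finset.sum_congr rfl fun g _ => ?_
  have h1 : ρ (1, q.out) (ρ (g, 1) m) = ρ (g, q.out) m := by
    rw [← Module.End.mul_apply, ← map_mul]; simp
  have h2 : ev (ω (g, q.out)⁻¹ ((μ ∘ₗ f.toLinearMap) ⊗ₜ x)) =
      μ (f (π g v)) * χ (τ q.out⁻¹ x) := by
    change μ (f (π g⁻¹⁻¹ v)) * χ (τ q.out⁻¹ x) = _
    rw [inv_inv]
  rw [map_smul, h1, smul_smul, h2, f.isIntertwining, mul_comm]

/-- The summand theorem for a central `p`-group `Q` in place of `Z`.  A nonzero `Q`-projective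
summand `U` would make some element `∑ l(q⁻¹ x) q` of `kG'`, with `x` in a simple submodule of `U`,
act nontrivially on `U`. -/
theorem tensorOver_hasNoNonzeroRelProjectiveSummand [Finite G']
    {ρ : Representation k (G × G') M} (hρ : IsIndecomposable ρ)
    {θ : Module.End k M} (hθ : ∑ g : G, conj ρ (g, 1) θ = 1)
    (hQ : IsPGroup p Q) {j : Q →* G} {j' : Q →* G'} (hj' : Function.Injective j')
    (hjc : j.range ≤ Subgroup.center G) (hjc' : j'.range ≤ Subgroup.center G')
    (hQM : ∀ u, ρ (j u, j' u) = 1) (hproj : ¬ IsRelProjective (j.prod j').range ρ)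
    {S : Type*} [AddCommGroup S] [Module k S] {σ : Representation k G S}
    (hσ : IsSpannedBySimples σ) :
    HasNoNonzeroRelProjectiveSummand j'.range (tensorOver σ ρ) := by
  intro U _ _ hU
  by_contra hne
  have := finiteDimensional_of_isRelProjective hU
  have : Nontrivial U.toSubmodule := Submodule.nontrivial_iff_ne_bot.2 fun h =>
    hne (Subrepresentation.toSubmodule_injective h)
  have := Fintype.ofFinite (G' ⧸ j'.range)
  obtain ⟨T, hT⟩ := exists_irreducible_subrepresentation U.toRepresentation
  have := nontrivial_of_irreducible hT
  obtain ⟨x, hx⟩ := exists_ne (0 : T.toSubmodule)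
  obtain ⟨n, α, hα⟩ := hU
  obtain ⟨φ, -, hφ⟩ := exists_trace_eq_one_of_isSummand_ind hα
  obtain ⟨l, n, hln⟩ := exists_rankOne_sum_ne_zero φ
    (fun q : G' ⧸ j'.range => U.toRepresentation q.out)
    (fun q => U.toRepresentation q.out⁻¹ x) (by
      have h := LinearMap.congr_fun hφ x
      rw [LinearMap.sum_apply] at h
      exact ne_of_eq_of_ne h fun h0 => hx (Subtype.ext h0))
  refine hln (Subtype.ext ?_)
  rw [ZeroMemClass.coe_zero, ← sum_smul_tensorOver_eq_zero hρ hθ hQ hj' hjc hjc' hQM hproj hσ hT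
    (l ∘ₗ T.toSubmodule.subtype) x n, AddSubmonoidClass.coe_finsetSum]
  rfl

/-- If `M` is projective over `kG`, writing a vector `x` of a simple `kG`-submodule of `M` as a norm
shows that some matrix coefficient `∑ μ(g⁻¹ x) g` of this simple module does not kill `M`; such an
element lies in `soc(kG)`. -/
theorem nontrivial_socRegular_tensorOver [Nontrivial M] {ρ : Representation k (G × G') M}
    {θ : Module.End k M} (hθ : ∑ g : G, conj ρ (g, 1) θ = 1) :
    Nontrivial (TensorOver (socRegular k G) ρ) := by
  let ρ₁ : Representation k G M := ρ.comp (MonoidHom.inl G G')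
  obtain ⟨T, hT⟩ := exists_irreducible_subrepresentation ρ₁
  have := nontrivial_of_irreducible hT
  obtain ⟨x, hx⟩ := exists_ne (0 : T.toSubmodule)
  obtain ⟨l, m, hlm⟩ := exists_rankOne_sum_ne_zero θ (fun g : G => ρ₁ g)
    (fun g => ρ₁ g⁻¹ x) (by
      have h : ∑ g : G, ρ₁ g (θ (ρ₁ g⁻¹ x)) = x := by
        refine Eq.trans ?_ (LinearMap.congr_fun hθ x)
        rw [LinearMap.sum_apply]
        refine Finset.sum_congr rfl fun g _ => ?_
        rw [conj_apply, Prod.inv_mk, inv_one]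
        rfl
      exact ne_of_eq_of_ne h fun h0 => hx (Subtype.ext h0))
  have := finiteDimensional_of_irreducible hT
  let μ : Module.Dual k T.toSubmodule := l ∘ₗ T.toSubmodule.subtype
  let a : (socle (rightRegular k G)).toSubmodule := ⟨matrixCoefficients T.toRepresentation x μ,
    mem_socle_of_irreducible (isIrreducible_dual hT) _ μ⟩
  have ha : (a : k[G]) = _ := matrixCoefficients_apply T.toRepresentation x μ
  refine ⟨tensorMk _ _ (a ⊗ₜ m), 0, fun h0 => hlm ?_⟩
  let ι : Representation.IntertwiningMap (socRegular k G) (rightRegular k G) :=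
    ⟨(socle (rightRegular k G)).toSubmodule.subtype, fun g => rfl⟩
  have hι : ι a = _ := ha
  rw [← map_zero (tensorOverMul ι ρ), ← h0, tensorOverMul_tmul, hι, map_sum, LinearMap.sum_apply]
  refine Finset.sum_congr rfl fun g _ => ?_
  rw [map_smul, Representation.asAlgebraHom_single_one]
  rfl

end Summands

end RightGroupModules

theorem proposition4 {k : Type*} [Field k] [IsAlgClosed k] (p : ℕ) (hp : p.Prime) [CharP k p]
    {G G' P : Type*} [Group G] [Finite G] [Group G'] [Finite G']
    [Group P] (hP : IsPGroup p P)
    (i : P →* G) (hi : Function.Injective i) (i' : P →* G') (hi' : Function.Injective i')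
    {M : Type*} [AddCommGroup M] [Module k M] [FiniteDimensional k M]
    (ρ : Representation k (G × G') M)
    (hM : RightGroupModules.IsTrivialSource ρ)
    (hvertex : RightGroupModules.IsVertex (RightGroupModules.diagonalSubgroup i i') ρ)
    (Z : Subgroup P) (hZ : Z < ⊤)
    (hZG : Z.map i ≤ Subgroup.center G) (hZG' : Z.map i' ≤ Subgroup.center G') :
    (Nontrivial (RightGroupModules.TensorOver (RightGroupModules.socRegular k G) ρ) ∧
      RightGroupModules.HasNoNonzeroRelProjectiveSummand (Z.map i')
        (RightGroupModules.tensorOver (RightGroupModules.socRegular k G) ρ)) ∧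
    ∀ (S : Type*) [AddCommGroup S] [Module k S] (σ : Representation k G S),
      σ.IsIrreducible →
      RightGroupModules.HasNoNonzeroRelProjectiveSummand (Z.map i')
        (RightGroupModules.tensorOver σ ρ) := by
  open RightGroupModules in
  classical
  have := Fact.mk hp
  have := Fintype.ofFinite G
  have := hM.1.1
  obtain ⟨θ, hθ⟩ := exists_sum_conj_eq_one_of_isRelProjective_diagonalSubgroup hi' hvertex.prop
  let j : Z →* G := i.comp Z.subtype
  let j' : Z →* G' := i'.comp Z.subtype
  have hj : j.range = Z.map i := by rw [MonoidHom.range_comp, Subgroup.range_subtype]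
  have hj' : j'.range = Z.map i' := by rw [MonoidHom.range_comp, Subgroup.range_subtype]
  have hle : (j.prod j').range ≤ diagonalSubgroup i i' := by
    rintro _ ⟨u, rfl⟩
    exact ⟨u, rfl⟩
  have hcenter : (j.prod j').range ≤ Subgroup.center (G × G') := by
    rintro _ ⟨u, rfl⟩
    rw [Subgroup.center_prod]
    exact ⟨hZG (hj ▸ ⟨u, rfl⟩), hZG' (hj' ▸ ⟨u, rfl⟩)⟩
  have hproj : ¬ IsRelProjective (j.prod j').range ρ := fun h => by
    refine hZ.not_ge fun u _ => ?_
    obtain ⟨z, hz⟩ := hvertex.le_of_le h hle ⟨u, rfl⟩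
    have : (z : P) = u := hi' (congrArg Prod.snd hz)
    exact this ▸ z.2
  have hQ := hP.to_subgroup Z
  have hinj : Function.Injective j' := hi'.comp Subtype.val_injective
  have hQM : ∀ u, ρ (j u, j' u) = 1 := fun u =>
    LinearMap.ext (apply_eq_self_of_mem_vertex hM hvertex hle hcenter ⟨u, rfl⟩)
  rw [← hj] at hZG
  rw [← hj'] at hZG' ⊢
  exact ⟨⟨nontrivial_socRegular_tensorOver hθ, tensorOver_hasNoNonzeroRelProjectiveSummand hM.1
      hθ hQ hinj hZG hZG' hQM hproj (isSpannedBySimples_socle _)⟩,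
    fun S _ _ σ hσ => tensorOver_hasNoNonzeroRelProjectiveSummand hM.1
      hθ hQ hinj hZG hZG' hQM hproj (isSpannedBySimples_of_irreducible hσ)⟩
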